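/- Let $K$ be a field and let $A=\bigoplus_{d\ge 0}A_d$ be a commutative graded $K$-algebra which is an integral domain. Let $f_1,\dots,f_n,g_1,\dots,g_m,h_1,\dots,h_l\in A$ be homogeneous elements of positive degree such that (a) $f_1,\dots,f_n,g_1,\dots,g_m$ form a homogeneous system of parameters of $A$, i.e. they are algebraically independent over $K$ and $A$ is integral over the subalgebra $K[f_1,\dots,f_n,g_1,\dots,g_m]$; (b) $\operatorname{Quot}(A)=K(f_1,\dots,f_n,g_1,\dots,g_m,h_1,\dots,h_l)$. Let $P:=K[X_1,\dots,X_n,Y_1,\dots,Y_m,Z_1,\dots,Z_l]$ be the polynomial ring, graded by $\deg X_i=\deg f_i$, $\deg Y_j=\deg g_j$, $\deg Z_k=\deg h_k$ (if an element is $0$, any positive integer may be chosen as its degree), and let $\phi\colon P\to A$ be the $K$-algebra homomorphism with $X_i\mapsto f_i$, $Y_j\mapsto g_j$, $Z_k\mapsto h_k$. Let $R_1,\dots,R_l\in\ker\phi$ be homogeneous, and suppose that (c) $X_1,\dots,X_n,Y_1,\dots,Y_m,R_1,\dots,R_l$ form a homogeneous system of parameters of $P$; (d) in $B:=P/(R_1,\dots,R_l)$,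 with $x:=\overline{X}_1\cdots\overline{X}_n$ and $y:=\overline{Y}_1\cdots\overline{Y}_m$ (bars denote classes in $B$), the localization $B_x=B[x^{-1}]$ is generated as a $K$-algebra by $x^{-1},\overline{X}_1,\dots,\overline{X}_n$ and $m$ further elements, and the localization $B_y=B[y^{-1}]$ is generated as a $K$-algebra by $y^{-1},\overline{Y}_1,\dots,\overline{Y}_m$ and $n$ further elements. Then $A=K[f_1,\dots,f_n,g_1,\dots,g_m,h_1,\dots,h_l]$; moreover, $A$ is a complete intersection (that is, $A$ is isomorphic, as a graded algebra, to a polynomial ring over $K$ in finitely many variables of positive degree modulo an ideal generated by a regular sequence of homogeneous polynomials), and $\ker\phi$ is generated as an ideal by $R_1,\dots,R_l$. -/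

import Mathlib

/-- A family `a` of elements of a graded `K`-algebra `A = ⨁ d, 𝒜 d` is a homogeneous system of
parameters: the `a i` are homogeneous of positive degree, they are algebraically independent
over `K`, and `A` is integral over the subalgebra `K[a i | i]`. -/
structure IsHomogeneousSOP (K : Type*) {A ι : Type*} [Field K] [CommRing A] [Algebra K A]
    (𝒜 : ℕ → Submodule K A) (a : ι → A) : Prop where
  homogeneous : ∀ i, ∃ d : ℕ, 0 < d ∧ a i ∈ 𝒜 d
  algebraicIndependent : AlgebraicIndependent K a
  integral : Algebra.IsIntegral (Algebra.adjoin K (Set.range a)) A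

/-- A graded `K`-algebra `A = ⨁ d, 𝒜 d` is a (graded) complete intersection: it is generated by
finitely many homogeneous elements `a i` of positive degrees `w i`, and the ideal of relations
between them, in the polynomial ring where the `i`-th variable has degree `w i`, is generated by
a regular sequence of homogeneous polynomials. -/
def IsGradedCompleteIntersection (K : Type*) {A : Type*} [Field K] [CommRing A] [Algebra K A]
    (𝒜 : ℕ → Submodule K A) : Prop :=
  ∃ (N : ℕ) (w : Fin N → ℕ) (a : Fin N → A) (rs : List (MvPolynomial (Fin N) K)),
    (∀ i, 0 < w i ∧ a i ∈ 𝒜 (w i)) ∧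
    Algebra.adjoin K (Set.range a) = ⊤ ∧
    (∀ r ∈ rs, ∃ d : ℕ, MvPolynomial.IsWeightedHomogeneous w r d) ∧
    RingTheory.Sequence.IsRegular (MvPolynomial (Fin N) K) rs ∧
    RingHom.ker (MvPolynomial.aeval a : MvPolynomial (Fin N) K →ₐ[K] A) = Ideal.ofList rs

/-- The localization `B[b⁻¹]` of the `K`-algebra `B` is generated, as a `K`-algebra, by `b⁻¹`,
the images of the elements `c i`, and `r` further elements. -/
def AwayGeneratedBy (K : Type*) {B ι : Type*} [Field K] [CommRing B] [Algebra K B]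
    (b : B) (c : ι → B) (r : ℕ) : Prop :=
  ∃ t : Fin r → Localization.Away b,
    Algebra.adjoin K
      ({IsLocalization.Away.invSelf b} ∪
        Set.range (fun i => algebraMap B (Localization.Away b) (c i)) ∪ Set.range t) = ⊤

/-!
Let `P` be the polynomial ring in the variables `X i`, `Y j`, `Z k`, let `B = P / (R)`, let `x` and
`y` be the products of the classes of the `X i` and of the `Y j`, and let `F` be the field of
fractions of `A`.

Since `P` is Cohen-Macaulay, the homogeneous system of parameters `R, X, Y` of `P` is a regular
sequence, and remains so after permuting `X` and `Y`
(`MvPolynomial.isWeaklyRegular_of_isIntegral`).  The question is reduced to the localization of `P`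
at the origin, because an element with nonzero constant term is a nonzerodivisor modulo every
homogeneous ideal.  In a Noetherian local ring `L`, a regular sequence of length `d` forces
`Ext^i(N, L) = 0` for `i < d` and `N` supported at the closed point (Rees).  An induction with
Nakayama's lemma extends the vanishing to `i + r < d` whenever `r` further elements cut the support
of `N` down to the closed point (`ModuleCat.subsingleton_ext_of_le_radical`).  Applied with `i = 0`
to the torsion of the first element of a system of parameters, it shows that this element is a
nonzerodivisor.  Consequently `R` is a regular sequence, each `X i` is a nonzerodivisor on `B`, and
each `Y j` is one modulo each `X i`, so that `x, y` behave like a regular sequence on `B`.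

The ring `B_x` is generated by `x⁻¹` and `n + m` elements, one for each `X i` and `m` more, and its
image in `F` contains the `n + m` algebraically independent elements `f, g`.  So the images of the
generators in `F` are algebraically independent, `B_x` is a localization of a polynomial ring, it
embeds into `F`, and it is integrally closed
(`AwayGeneratedBy.injective_and_exists_mul_pow_eq`).  As `x` is a nonzerodivisor, `B` embeds into
`F`, which says that the kernel of `P → A` is generated by `R`.

Finally, an element `a` of `A` is integral over `B` and lies in the field of fractions `F` of `B`,
so it lies in `B_x` and, by symmetry, in `B_y`.  These two rings meet in `B`, because `y` is a
nonzerodivisor modulo `x` (`exists_eq_of_mul_eq_of_mul_eq`).  Hence `P → A` is surjective.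
-/

/-! ### Depth and systems of parameters in local rings -/

section Depth

open CategoryTheory Abelian IsLocalRing RingTheory.Sequence Module Pointwise

universe u

variable {R : Type u} [CommRing R] [IsLocalRing R] [IsNoetherianRing R]

/-- If multiplication by `a` is injective on `N` and `Ext^(i+1)(N/aN, M)` vanishes, then so does
`Ext^i(N, M)`: multiplication by `a` is surjective on it, and Nakayama's lemma applies. -/
lemma ModuleCat.subsingleton_ext_of_quotSMulTop (N M : ModuleCat.{u} R) [Module.Finite R N]
    [Module.Finite R M] {a : R} (ha : a ∈ maximalIdeal R) (reg : IsSMulRegular N a) (i : ℕ)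
    (h : Subsingleton (Ext (ModuleCat.of R (QuotSMulTop a N)) M (i + 1))) :
    Subsingleton (Ext N M i) := by
  have hS := reg.smulShortComplex_shortExact
  by_contra! ntr
  have hmem : a ∈ (Module.annihilator R (Ext N M i)).jacobson :=
    (IsLocalRing.maximalIdeal_le_jacobson _) ha
  refine Submodule.top_ne_pointwise_smul_of_mem_jacobson_annihilator hmem ?_
  rw [eq_comm, eq_top_iff]
  intro y _
  obtain ⟨z, hz⟩ : ∃ z : Ext N M i, (Ext.mk₀ (a • 𝟙 N)).comp z (zero_add i) = y :=
    Ext.contravariant_sequence_exact₁ hS M y (add_comm 1 i) (h.elim _ _)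
  rw [Ext.mk₀_smul, Ext.smul_comp, Ext.mk₀_id_comp] at hz
  rw [← hz]
  exact Submodule.smul_mem_pointwise_smul _ _ ⊤ trivial

/-- Let `M` have depth at least `d`, expressed by the vanishing of `Ext^i(N, M)` for `i < d` and all
finite modules `N` supported at the closed point.  If the support of `N` meets the zero locus of
`s` only in the closed point, then `Ext^i(N, M)` vanishes for `i + |s| < d`. -/
lemma ModuleCat.subsingleton_ext_of_le_radical (M : ModuleCat.{u} R) [Module.Finite R M] (d : ℕ)
    (hM : ∀ N : ModuleCat.{u} R, Module.Finite R N →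
      maximalIdeal R ≤ (Module.annihilator R N).radical → ∀ i < d, Subsingleton (Ext N M i))
    (s : List R) (hs : ∀ r ∈ s, r ∈ maximalIdeal R) (N : ModuleCat.{u} R) [Module.Finite R N]
    (hN : maximalIdeal R ≤ (Module.annihilator R N ⊔ Ideal.ofList s).radical)
    (i : ℕ) (hi : i + s.length < d) : Subsingleton (Ext N M i) := by
  induction s generalizing N i with
  | nil => exact hM N inferInstance (by simpa using hN) i (by simpa using hi)
  | cons a s ih =>
    simp only [List.mem_cons, forall_eq_or_imp] at hs
    simp only [List.length_cons] at hi
    obtain ⟨k, hk⟩ := monotone_stabilizes_iff_noetherian.mpr (inferInstance : IsNoetherian R N)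
      (⟨fun k => Submodule.torsionBy R N (a ^ k), fun k l hkl x hx => by
        rw [Submodule.mem_torsionBy_iff] at hx ⊢
        rw [← Nat.sub_add_cancel hkl, pow_add, mul_smul, hx, smul_zero]⟩ :
          ℕ →o Submodule R N)
    -- `T` is the `a`-power torsion of `N`, so that `a` acts injectively on `N / T`
    set T := Submodule.torsionBy R N (a ^ k) with hT
    have hkT : Submodule.torsionBy R N (a ^ (k + 1)) = T := (hk (k + 1) (Nat.le_succ k)).symm
    have reg : IsSMulRegular (N ⧸ T) a := by
      rw [isSMulRegular_quotient_iff_mem_of_smul_mem]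
      intro x hx
      rw [← hkT, Submodule.mem_torsionBy_iff, pow_succ, mul_smul]
      exact (Submodule.mem_torsionBy_iff _ _).mp hx
    have key (N' : Type u) [AddCommGroup N'] [Module R N']
        (h1 : Module.annihilator R N ≤ Module.annihilator R N')
        (h2 : a ∈ (Module.annihilator R N').radical) :
        maximalIdeal R ≤ (Module.annihilator R N' ⊔ Ideal.ofList s).radical := by
      refine hN.trans (Ideal.radical_le_radical_iff.mpr ?_)
      rw [Ideal.ofList_cons]
      refine sup_le (h1.trans (le_sup_left.trans Ideal.le_radical)) (sup_le ?_
        (le_sup_right.trans Ideal.le_radical))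
      rw [Ideal.span_singleton_le_iff_mem]
      exact Ideal.radical_mono le_sup_left h2
    have hsurj : Module.annihilator R N ≤ Module.annihilator R (N ⧸ T) :=
      LinearMap.annihilator_le_of_surjective _ T.mkQ_surjective
    have hTsub : Subsingleton (Ext (ModuleCat.of R T) M i) := by
      refine ih hs.2 (ModuleCat.of R T) ?_ i (by omega)
      refine key T (LinearMap.annihilator_le_of_injective _ T.injective_subtype) ⟨k, ?_⟩
      rw [Module.mem_annihilator]
      intro x
      exact Subtype.ext ((Submodule.mem_torsionBy_iff _ _).mp x.2)
    have hQsub : Subsingleton (Ext (ModuleCat.of R (N ⧸ T)) M i) := by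
      refine ModuleCat.subsingleton_ext_of_quotSMulTop _ M hs.1 reg i ?_
      refine ih hs.2 (ModuleCat.of R (QuotSMulTop a (N ⧸ T))) ?_ (i + 1) (by omega)
      refine key (QuotSMulTop a (N ⧸ T)) (hsurj.trans
        (LinearMap.annihilator_le_of_surjective _ (Submodule.mkQ_surjective _)))
        (Ideal.le_radical (QuotSMulTop.mem_annihilator _ a))
    have hS := LinearMap.shortExact_shortComplexKer T.mkQ_surjective
    have e : Subsingleton (Ext (ModuleCat.of R (LinearMap.ker T.mkQ)) M i) := by
      rw [Submodule.ker_mkQ]; exact hTsub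
    refine ⟨fun x y => ?_⟩
    rw [← sub_eq_zero]
    obtain ⟨z, hz⟩ := Ext.contravariant_sequence_exact₂ hS M (x - y) (e.elim _ _)
    have : z = 0 := hQsub.elim _ _
    rw [← hz, this, Ext.comp_zero]

/-- On a finite module `M` of depth at least `d` over a Noetherian local ring, every sequence of at
most `d` elements is regular if its zero locus meets the support of `M` only in the closed point.
This applies to systems of parameters of Cohen-Macaulay modules. -/
lemma RingTheory.Sequence.isWeaklyRegular_of_le_radical (M : ModuleCat.{u} R) [Module.Finite R M]
    (d : ℕ) (hM : ∀ N : ModuleCat.{u} R, Module.Finite R N →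
      maximalIdeal R ≤ (Module.annihilator R N).radical → ∀ i < d, Subsingleton (Ext N M i))
    (s : List R) (hs : ∀ r ∈ s, r ∈ maximalIdeal R) (hd : s.length ≤ d)
    (hrad : maximalIdeal R ≤ (Module.annihilator R M ⊔ Ideal.ofList s).radical) :
    IsWeaklyRegular M s := by
  induction s generalizing M d with
  | nil => exact .nil R M
  | cons a s ih =>
    simp only [List.mem_cons, forall_eq_or_imp] at hs
    simp only [List.length_cons] at hd
    -- the `a`-torsion `T` of `M` is killed by `a`, so that `Hom(T, M)` vanishes
    set T := Submodule.torsionBy R M a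
    have hsub : Subsingleton (Ext (ModuleCat.of R T) M 0) := by
      refine ModuleCat.subsingleton_ext_of_le_radical M d hM s hs.2 _ ?_ 0 (by omega)
      refine hrad.trans (Ideal.radical_mono ?_)
      rw [Ideal.ofList_cons, ← sup_assoc]
      refine sup_le_sup_right (sup_le
        (LinearMap.annihilator_le_of_injective _ T.injective_subtype) ?_) _
      rw [Ideal.span_singleton_le_iff_mem, Module.mem_annihilator]
      exact fun x => Subtype.ext ((Submodule.mem_torsionBy_iff _ _).mp x.2)
    have hreg : IsSMulRegular M a := by
      rw [isSMulRegular_iff_right_eq_zero_of_smul]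
      intro x hx
      have : Subsingleton (T →ₗ[R] M) := (Ext.addEquiv₀.trans
        (ModuleCat.homAddEquiv (M := ModuleCat.of R T) (N := M))).symm.subsingleton
      have h0 : T.subtype = 0 := Subsingleton.elim _ _
      exact LinearMap.congr_fun h0 ⟨x, (Submodule.mem_torsionBy_iff _ _).mpr hx⟩
    refine .cons hreg (ih (ModuleCat.of R (QuotSMulTop a M)) (d - 1) ?_ hs.2 (by omega) ?_)
    · intro N hNf hN i hi
      have h1 := hM N hNf hN i (by omega)
      have h2 := hM N hNf hN (i + 1) (by omega)
      refine ⟨fun x y => ?_⟩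
      rw [← sub_eq_zero]
      obtain ⟨z, hz⟩ := Ext.covariant_sequence_exact₃ N hreg.smulShortComplex_shortExact
        (x - y) rfl (h2.elim _ _)
      have : z = 0 := h1.elim _ _
      rw [← hz, this, Ext.zero_comp]
      rfl
    · refine hrad.trans (Ideal.radical_mono ?_)
      rw [Ideal.ofList_cons, ← sup_assoc]
      refine sup_le_sup_right (sup_le
        (LinearMap.annihilator_le_of_surjective _ (Submodule.mkQ_surjective _)) ?_) _
      rw [Ideal.span_singleton_le_iff_mem]
      exact QuotSMulTop.mem_annihilator M a

/-- In a Noetherian local ring whose depth is at least `d`, witnessed by a regular sequence `rs`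
of length `d`, every sequence of at most `d` elements generating an ideal primary to the maximal
ideal is regular. -/
lemma RingTheory.Sequence.IsRegular.isWeaklyRegular_of_le_radical {rs s : List R}
    (hrs : IsRegular R rs) (hrs_mem : ∀ r ∈ rs, r ∈ maximalIdeal R)
    (hs : ∀ r ∈ s, r ∈ maximalIdeal R) (hd : s.length ≤ rs.length)
    (hrad : maximalIdeal R ≤ (Ideal.ofList s).radical) : IsWeaklyRegular R s := by
  refine RingTheory.Sequence.isWeaklyRegular_of_le_radical (ModuleCat.of R R) rs.length ?_ s hs hd
    (hrad.trans (Ideal.radical_mono le_sup_right))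
  intro N _ hN
  refine ModuleCat.subsingleton_ext_of_exists_isRegular (maximalIdeal R) N ?_ _ ?_ rs hrs_mem hrs
  · rwa [Module.support_eq_zeroLocus, PrimeSpectrum.zeroLocus_subset_zeroLocus_iff]
  · rw [lt_top_iff_ne_top, smul_eq_mul, Ideal.mul_top]
    exact (maximalIdeal.isMaximal R).ne_top

end Depth

/-! ### Regular sequences of homogeneous polynomials -/

section GradedDescent

open RingTheory.Sequence

/-- Regularity of a sequence of ring elements on the ring itself, in terms of ideal membership. -/
lemma RingTheory.Sequence.isWeaklyRegular_self_iff {R : Type*} [CommRing R] (rs : List R) :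
    IsWeaklyRegular R rs ↔ ∀ (i : ℕ) (h : i < rs.length) (x : R),
      rs[i] * x ∈ Ideal.ofList (rs.take i) → x ∈ Ideal.ofList (rs.take i) := by
  simp_rw [isWeaklyRegular_iff, isSMulRegular_quotient_iff_mem_of_smul_mem, smul_eq_mul,
    Ideal.mul_top]

variable {P σ : Type*} [CommRing P] [SetLike σ P] [AddSubmonoidClass σ P]
  (𝒜 : ℕ → σ) [GradedRing 𝒜]

/-- An element whose component of degree `0` is a unit is a nonzerodivisor modulo every homogeneous
ideal. -/
lemma Ideal.IsHomogeneous.mem_of_mul_mem {I : Ideal P} (hI : I.IsHomogeneous 𝒜) {s p : P}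
    (hs : IsUnit (DirectSum.decompose 𝒜 s 0 : P)) (h : s * p ∈ I) : p ∈ I := by
  classical
  rw [hI.mem_iff]
  intro d
  induction d using Nat.strong_induction_on with
  | _ d ih =>
    have h1 : (DirectSum.decompose 𝒜 (s * p) d : P) ∈ I := hI d h
    rw [DirectSum.decompose_mul, DirectSum.coe_mul_apply_eq_sum_antidiagonal,
      ← Finset.add_sum_erase _ _
        (show (0, d) ∈ Finset.HasAntidiagonal.antidiagonal d by simp)] at h1
    have h2 := (Ideal.add_mem_iff_left I (Ideal.sum_mem I ?_)).mp h1
    · exact (Ideal.unit_mul_mem_iff_mem I hs).mp h2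
    · rintro ⟨a, b⟩ hab
      simp only [Finset.mem_erase, ne_eq, Prod.mk.injEq, not_and,
        Finset.HasAntidiagonal.mem_antidiagonal] at hab
      exact I.mul_mem_left _ (ih b (by omega))

/-- Regularity of a sequence of homogeneous elements descends from the localization at a prime ideal
outside of which all elements have invertible component of degree `0`. -/
lemma RingTheory.Sequence.IsWeaklyRegular.of_localization_of_homogeneous (𝔭 : Ideal P) [𝔭.IsPrime]
    (h𝔭 : ∀ s ∉ 𝔭, IsUnit (DirectSum.decompose 𝒜 s 0 : P)) (L : Type*) [CommRing L] [Algebra P L]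
    [IsLocalization.AtPrime L 𝔭] {rs : List P} (hrs : ∀ r ∈ rs, SetLike.IsHomogeneousElem 𝒜 r)
    (h : IsWeaklyRegular L (rs.map (algebraMap P L))) : IsWeaklyRegular P rs := by
  rw [isWeaklyRegular_self_iff] at h ⊢
  intro i hi x hx
  have h1 := h i (by simpa using hi) (algebraMap P L x) (by
    rw [List.getElem_map, ← List.map_take, ← map_mul, ← Ideal.map_ofList]
    exact Ideal.mem_map_of_mem _ hx)
  rw [← List.map_take, ← Ideal.map_ofList,
    IsLocalization.algebraMap_mem_map_algebraMap_iff 𝔭.primeCompl] at h1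
  obtain ⟨m, hm, hmx⟩ := h1
  refine Ideal.IsHomogeneous.mem_of_mul_mem 𝒜 ?_ (h𝔭 m hm) hmx
  exact Ideal.homogeneous_span _ _ fun r hr => hrs r (List.mem_of_mem_take hr)

end GradedDescent

namespace MvPolynomial

open RingTheory.Sequence IsLocalRing

variable {σ K : Type*}

/-- Distinct variables form a regular sequence. -/
lemma isWeaklyRegular_map_X [CommRing K] {l : List σ} (hl : l.Nodup) :
    IsWeaklyRegular (MvPolynomial σ K) (l.map (X : σ → MvPolynomial σ K)) := by
  rw [isWeaklyRegular_self_iff]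
  intro i hi x hx
  have hspan : Ideal.ofList ((l.map (X (R := K))).take i) =
      Ideal.span ((X : σ → MvPolynomial σ K) '' {j | j ∈ l.take i}) := by
    rw [← List.map_take, Ideal.ofList]
    congr 1
    ext
    simp only [List.mem_map, Set.mem_ofPred_eq, Set.mem_image]
  rw [hspan, mem_ideal_span_X_image] at hx ⊢
  simp only [List.length_map] at hi
  intro m hm
  obtain ⟨j, hj, hjm⟩ := hx (Finsupp.single l[i] 1 + m) (by
    rw [List.getElem_map, support_X_mul]; simpa using hm)
  refine ⟨j, hj, ?_⟩
  have hne : l[i] ≠ j := by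
    rintro rfl
    obtain ⟨k, hk, hkl⟩ := List.mem_take_iff_getElem.mp hj
    have := (hl.getElem_inj_iff).mp hkl
    omega
  simpa [Finsupp.single_apply, hne] using hjm

variable [Field K]

/-- If the polynomial ring is integral over polynomials `a i` without constant term, then the ideal
of the origin is the only prime ideal that contains all `a i` and is contained in it: by integrality,
such a prime ideal is maximal, since it contracts to the ideal of elements without constant term of
`K[a]`. -/
lemma eq_ker_constantCoeff_of_isIntegral {ι : Type*} {a : ι → MvPolynomial σ K}
    (ha : ∀ i, constantCoeff (a i) = 0)
    [Algebra.IsIntegral (Algebra.adjoin K (Set.range a)) (MvPolynomial σ K)]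
    (Q : Ideal (MvPolynomial σ K)) [Q.IsPrime] (haQ : ∀ i, a i ∈ Q)
    (hQ : Q ≤ RingHom.ker (constantCoeff (σ := σ) (R := K))) :
    Q = RingHom.ker (constantCoeff (σ := σ) (R := K)) := by
  have hmem : ∀ c ∈ Algebra.adjoin K (Set.range a), c - C (constantCoeff c) ∈ Q := by
    intro c hc
    induction hc using Algebra.adjoin_induction with
    | mem x hx => obtain ⟨i, rfl⟩ := hx; simpa [ha i] using haQ i
    | algebraMap r => simp [algebraMap_eq]
    | add x y _ _ hx hy =>
      rw [map_add, map_add, add_sub_add_comm]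
      exact Q.add_mem hx hy
    | mul x y _ _ hx hy =>
      have : x * y - C (constantCoeff (x * y)) = (x - C (constantCoeff x)) * y +
          C (constantCoeff x) * (y - C (constantCoeff y)) := by
        rw [map_mul, map_mul]; ring
      rw [this]
      exact Q.add_mem (Q.mul_mem_right _ hx) (Q.mul_mem_left _ hy)
  have hcomap : Q.comap (algebraMap (Algebra.adjoin K (Set.range a)) (MvPolynomial σ K)) =
      RingHom.ker ((constantCoeff (σ := σ) (R := K)).comp
        (algebraMap (Algebra.adjoin K (Set.range a)) (MvPolynomial σ K))) := by
    ext c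
    rw [Ideal.mem_comap, RingHom.mem_ker, RingHom.comp_apply]
    refine ⟨fun hc => hQ hc, fun hc => ?_⟩
    have := hmem _ c.2
    rwa [show constantCoeff (c : MvPolynomial σ K) = 0 from hc, map_zero, sub_zero] at this
  have hmax :
      (Q.comap (algebraMap (Algebra.adjoin K (Set.range a)) (MvPolynomial σ K))).IsMaximal := by
    rw [hcomap]
    refine RingHom.ker_isMaximal_of_surjective _ fun r => ⟨algebraMap K _ r, ?_⟩
    rw [RingHom.comp_apply, ← IsScalarTower.algebraMap_apply, algebraMap_eq, constantCoeff_C]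
  have := Ideal.isMaximal_of_isIntegral_of_isMaximal_comap Q hmax
  exact this.eq_of_le (RingHom.ker_ne_top _) hQ

/-- If the polynomial ring is integral over the polynomials `s` without constant term, then `s`
generates an ideal primary to the maximal ideal in the localization at the origin. -/
lemma maximalIdeal_le_radical_ofList {s : List (MvPolynomial σ K)}
    (hs : ∀ r ∈ s, constantCoeff r = 0)
    [hint : Algebra.IsIntegral (Algebra.adjoin K {r | r ∈ s}) (MvPolynomial σ K)]
    (𝔭 : Ideal (MvPolynomial σ K)) [𝔭.IsPrime]
    (h𝔭 : 𝔭 = RingHom.ker (constantCoeff (σ := σ) (R := K))) (L : Type*) [CommRing L]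
    [IsLocalRing L] [Algebra (MvPolynomial σ K) L] [IsLocalization.AtPrime L 𝔭] :
    maximalIdeal L ≤ (Ideal.ofList (s.map (algebraMap (MvPolynomial σ K) L))).radical := by
  rw [Ideal.radical_eq_sInf]
  refine le_sInf fun Q' ⟨hQ', hprime⟩ => ?_
  have hr : {r | r ∈ s} = Set.range (fun i : Fin s.length => s[i]) := by
    ext r; simp [List.mem_iff_get]
  rw [hr] at hint
  have hle : Q'.comap (algebraMap (MvPolynomial σ K) L) ≤ 𝔭 := by
    intro x hx
    rw [← IsLocalization.AtPrime.to_map_mem_maximal_iff L 𝔭 x inferInstance]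
    exact le_maximalIdeal hprime.ne_top hx
  have hsQ : ∀ i : Fin s.length, s[i] ∈ Q'.comap (algebraMap (MvPolynomial σ K) L) := fun i =>
    hQ' (Ideal.subset_span (List.mem_map_of_mem (List.getElem_mem _)))
  have hs' : ∀ i : Fin s.length, constantCoeff s[i] = 0 := fun i => hs _ (List.getElem_mem _)
  have : (Q'.comap (algebraMap (MvPolynomial σ K) L)).IsPrime := hprime.comap _
  have hQ : Q'.comap (algebraMap (MvPolynomial σ K) L) = 𝔭 :=
    (eq_ker_constantCoeff_of_isIntegral hs' _ hsQ (hle.trans_eq h𝔭)).trans h𝔭.symm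
  rw [← IsLocalization.AtPrime.map_eq_maximalIdeal 𝔭 L, ← hQ]
  exact Ideal.map_comap_le

/-- The polynomial ring is Cohen-Macaulay: a sequence of at most `|σ|` weighted homogeneous
polynomials of positive degrees over which the polynomial ring is integral is regular. -/
lemma isWeaklyRegular_of_isIntegral [Fintype σ] {w : σ → ℕ} (hw : ∀ i, w i ≠ 0)
    {s : List (MvPolynomial σ K)}
    (hs : ∀ r ∈ s, ∃ d : ℕ, 0 < d ∧ IsWeightedHomogeneous w r d)
    (hlen : s.length ≤ Fintype.card σ)
    [Algebra.IsIntegral (Algebra.adjoin K {r | r ∈ s}) (MvPolynomial σ K)] :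
    IsWeaklyRegular (MvPolynomial σ K) s := by
  classical
  let := weightedGradedAlgebra K w
  set 𝔭 := RingHom.ker (constantCoeff (σ := σ) (R := K)) with h𝔭
  have : 𝔭.IsPrime := RingHom.ker_isPrime _
  have hs0 : ∀ r ∈ s, constantCoeff r = 0 := by
    intro r hr
    obtain ⟨d, hd, hrd⟩ := hs r hr
    by_contra hne
    have := hrd (d := 0) hne
    simp at this
    omega
  set L := Localization.AtPrime 𝔭
  have : IsNoetherianRing L := IsLocalization.isNoetherianRing 𝔭.primeCompl _ inferInstance
  refine .of_localization_of_homogeneous (weightedHomogeneousSubmodule K w) 𝔭 ?_ L ?_ ?_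
  · intro f hf
    have h0 : (DirectSum.decompose (weightedHomogeneousSubmodule K w) f 0 : MvPolynomial σ K) =
        C (constantCoeff f) := (weightedDecomposition.decompose'_apply K w f 0).trans
      (weightedHomogeneousComponent_zero f hw)
    rw [h0]
    exact (isUnit_iff_ne_zero.mpr hf).map C
  · exact fun r hr => let ⟨d, _, h⟩ := hs r hr; ⟨d, h⟩
  · have hX := (isWeaklyRegular_map_X (K := K) (Finset.univ : Finset σ).nodup_toList
      ).isRegular_of_isLocalization_of_mem L 𝔭 (by simp [h𝔭])
    have hmem : ∀ l : List (MvPolynomial σ K), (∀ r ∈ l, constantCoeff r = 0) →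
        ∀ r ∈ l.map (algebraMap (MvPolynomial σ K) L), r ∈ maximalIdeal L := by
      intro l hl r hr
      obtain ⟨p, hp, rfl⟩ := List.mem_map.mp hr
      rw [← Localization.AtPrime.map_eq_maximalIdeal]
      exact Ideal.mem_map_of_mem _ (hl p hp)
    refine hX.isWeaklyRegular_of_le_radical ?_ ?_ (by simpa using hlen) ?_
    · exact hmem _ (by simp)
    · exact hmem _ hs0
    · exact maximalIdeal_le_radical_ofList hs0 𝔭 h𝔭 L

end MvPolynomial

/-! ### Generators of a localization and algebraic independence -/

section AlgebraicIndependence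

/-- A family `v` of as many elements as an algebraically independent family `a`, all of whose
members are algebraic over `K[v]`, is algebraically independent. -/
lemma AlgebraicIndependent.of_isAlgebraic_adjoin {K F ι : Type*} [Field K] [Field F] [Algebra K F]
    [Finite ι] {a v : ι → F} (ha : AlgebraicIndependent K a)
    (h : ∀ i, IsAlgebraic (Algebra.adjoin K (Set.range v)) (a i)) : AlgebraicIndependent K v := by
  set M := AlgebraicIndependent.matroid K F
  have hMa : M.Indep (Set.range a) := matroid_indep_iff.mpr ha.to_subtype_range
  have hsub : Set.range a ⊆ M.closure (Set.range v) := by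
    rw [matroid_closure_eq]
    rintro _ ⟨i, rfl⟩
    exact h i
  have h1 : (Set.range a).encard ≤ M.eRk (Set.range v) := by
    rw [← M.eRk_closure_eq]
    exact hMa.encard_le_eRk_of_subset hsub
  have h2 : (Set.range a).encard = (Set.univ : Set ι).encard := by
    rw [← Set.image_univ, ha.injective.encard_image]
  have h3 : (Set.range v).encard ≤ (Set.univ : Set ι).encard := by
    rw [← Set.image_univ]; exact Set.encard_image_le v _
  -- `|a| ≤ rank v ≤ |range v| ≤ |ι| = |a|`, so that equality holds throughout
  have h4 : M.eRk (Set.range v) = (Set.range v).encard :=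
    le_antisymm (M.eRk_le_encard _) (h3.trans (h2 ▸ h1))
  have hinj : Function.Injective v := by
    rw [← Set.injOn_univ]
    refine Set.Finite.injOn_of_encard_image_eq Set.finite_univ (le_antisymm ?_ ?_)
    · exact Set.encard_image_le v _
    · rw [Set.image_univ, ← h2]
      exact h1.trans h4.le
  refine .of_subtype_range hinj (matroid_indep_iff.mp ?_)
  exact (Matroid.indep_iff_eRk_eq_encard_of_finite (Set.finite_range v)).mpr h4

end AlgebraicIndependence

section AwayGenerated

open MvPolynomial

variable {K B F ι : Type*} [Field K] [CommRing B] [Algebra K B] [Field F] [Algebra K F]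

/-- Let `L` be generated by `u⁻¹` and by finite families `c` and `t`, where `u` is a product of
members of `c`, and let `L` map to a field `F`.  If the image of `L` contains an algebraically independent
family of as many elements as `c` and `t` have together, then the images of `c` and `t` are
algebraically independent. -/
lemma algebraicIndependent_of_adjoin_eq_top {κ L : Type*} [Finite ι] [Finite κ] [CommRing L]
    [Algebra K L]
    (u : L) (c : ι → L) (t : κ → L) (hu : u ∈ Submonoid.closure (Set.range c)) (u' : L)
    (huu : u * u' = 1) (ht : Algebra.adjoin K ({u'} ∪ Set.range c ∪ Set.range t) = ⊤)
    (φ : L →ₐ[K] F) (a : ι ⊕ κ → L) (ha : AlgebraicIndependent K (φ ∘ a)) :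
    AlgebraicIndependent K (φ ∘ Sum.elim c t) := by
  refine ha.of_isAlgebraic_adjoin fun i => ?_
  set S := Algebra.adjoin K (Set.range (φ ∘ Sum.elim c t))
  have hmem : ∀ j, φ (Sum.elim c t j) ∈ S := fun j => Algebra.subset_adjoin ⟨j, rfl⟩
  have halg : ∀ s ∈ S, IsAlgebraic S s := fun s hs => isAlgebraic_algebraMap (⟨s, hs⟩ : S)
  have key : ∀ z ∈ Algebra.adjoin K ({u'} ∪ Set.range c ∪ Set.range t), IsAlgebraic S (φ z) := by
    intro z hz
    induction hz using Algebra.adjoin_induction with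
    | mem z hz =>
      rcases hz with (rfl | ⟨j, rfl⟩) | ⟨j, rfl⟩
      · have h1 : φ z = (φ u)⁻¹ := by
          rw [eq_comm, inv_eq_of_mul_eq_one_right]
          rw [← map_mul, huu, map_one]
        rw [h1]
        refine (halg _ ?_).inv
        have : Submonoid.closure (Set.range c) ≤ S.toSubmonoid.comap φ := by
          rw [Submonoid.closure_le]
          rintro _ ⟨j, rfl⟩
          exact hmem (Sum.inl j)
        exact this hu
      · exact halg _ (hmem (Sum.inl j))
      · exact halg _ (hmem (Sum.inr j))
    | algebraMap r =>
      rw [AlgHom.commutes]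
      exact halg _ (S.algebraMap_mem r)
    | add x y _ _ hx hy => rw [map_add]; exact hx.add hy
    | mul x y _ _ hx hy => rw [map_mul]; exact hx.mul hy
  exact key _ (ht ▸ Algebra.mem_top)

/-- If a ring `L` is generated by `u⁻¹` and a finite family `v` with `u = aeval v q`, then every
element of `L` becomes a polynomial in `v` after multiplication with a power of `u`. -/
lemma exists_pow_mul_eq_aeval {L : Type*} [CommRing L] [Algebra K L] {v : ι → L}
    (q : MvPolynomial ι K) {u' : L} (huu : aeval v q * u' = 1)
    (ht : Algebra.adjoin K ({u'} ∪ Set.range v) = ⊤) (z : L) :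
    ∃ (k : ℕ) (p : MvPolynomial ι K), z * aeval v q ^ k = aeval v p := by
  have hz : z ∈ Algebra.adjoin K ({u'} ∪ Set.range v) := ht ▸ Algebra.mem_top
  induction hz using Algebra.adjoin_induction with
  | mem z hz =>
    rcases hz with rfl | ⟨j, rfl⟩
    · exact ⟨1, 1, by rw [pow_one, mul_comm, huu, map_one]⟩
    · exact ⟨0, X j, by simp⟩
  | algebraMap r => exact ⟨0, C r, by simp⟩
  | add x y _ _ hx hy =>
    obtain ⟨k, p, hp⟩ := hx
    obtain ⟨k', p', hp'⟩ := hy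
    refine ⟨k + k', p * q ^ k' + p' * q ^ k, ?_⟩
    simp only [map_add, map_mul, map_pow, ← hp, ← hp']
    ring
  | mul x y _ _ hx hy =>
    obtain ⟨k, p, hp⟩ := hx
    obtain ⟨k', p', hp'⟩ := hy
    refine ⟨k + k', p * p', ?_⟩
    simp only [map_mul, ← hp, ← hp']
    ring

/-- If moreover the images of `v` in a field `F` are algebraically independent, then `L` is a
localization of the polynomial ring in `v`.  So it embeds into `F`, and it is integrally closed. -/
lemma injective_and_isIntegrallyClosed_of_algebraicIndependent {L : Type*} [CommRing L]
    [Algebra K L] {v : ι → L} (q : MvPolynomial ι K) {u' : L} (huu : aeval v q * u' = 1)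
    (ht : Algebra.adjoin K ({u'} ∪ Set.range v) = ⊤) (φ : L →ₐ[K] F)
    (hv : AlgebraicIndependent K (φ ∘ v)) :
    Function.Injective φ ∧ IsIntegrallyClosed L := by
  have hcomp : ∀ p : MvPolynomial ι K, φ (aeval v p) = aeval (φ ∘ v) p := fun p =>
    comp_aeval_apply v φ p
  have hinjv : ∀ p : MvPolynomial ι K, aeval v p = 0 → p = 0 := fun p hp =>
    hv.eq_zero_of_aeval_eq_zero p (by rw [← hcomp, hp, map_zero])
  have hunit : IsUnit (aeval v q) := IsUnit.of_mul_eq_one _ huu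
  have hφ : Function.Injective φ := by
    rw [injective_iff_map_eq_zero]
    intro z hz
    obtain ⟨k, p, hp⟩ := exists_pow_mul_eq_aeval q huu ht z
    have : p = 0 := hv.eq_zero_of_aeval_eq_zero p (by rw [← hcomp, ← hp, map_mul, hz, zero_mul])
    rw [this, map_zero] at hp
    exact (hunit.pow k).mul_left_eq_zero.mp hp
  refine ⟨hφ, ?_⟩
  have : IsDomain L := hφ.isDomain φ.toRingHom
  let := (aeval v : MvPolynomial ι K →ₐ[K] L).toRingHom.toAlgebra
  have hq : q ≠ 0 := by
    rintro rfl
    simp at hunit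
  have : IsLocalization (Submonoid.powers q) L := by
    rw [isLocalization_iff]
    refine ⟨?_, fun z => ?_, fun {x y} hxy => ⟨1, ?_⟩⟩
    · rintro ⟨_, k, rfl⟩
      change IsUnit (aeval v (q ^ k))
      rw [map_pow]
      exact hunit.pow k
    · obtain ⟨k, p, hp⟩ := exists_pow_mul_eq_aeval q huu ht z
      refine ⟨(p, ⟨q ^ k, k, rfl⟩), ?_⟩
      change z * aeval v (q ^ k) = aeval v p
      rw [map_pow, hp]
    · have : aeval v (x - y) = 0 := by rw [map_sub, sub_eq_zero]; exact hxy
      rw [sub_eq_zero.mp (hinjv _ this)]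
  exact isIntegrallyClosed_of_isLocalization L (Submonoid.powers q)
    (powers_le_nonZeroDivisors_of_noZeroDivisors hq)

/-- Let `π : B → F` map `b` to a nonzero element of a field, and let `B[b⁻¹]` be generated by `b⁻¹`,
the factors `c i` of `b` and `r` more elements, where `|ι| + r` elements of the image of `π` are
algebraically independent.  Then `π` is injective if `b` is a nonzerodivisor.  If `F` is the field
of fractions of the image, every element of `F` that is integral over `B` belongs to the image of
`B[b⁻¹]`. -/
theorem AwayGeneratedBy.injective_and_exists_mul_pow_eq {ι : Type*} [Fintype ι] {b : B}
    {c : ι → B} (hb : b = ∏ i, c i) {r : ℕ} (h : AwayGeneratedBy K b c r) (π : B →ₐ[K] F)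
    (hπb : π b ≠ 0)
    (a : ι ⊕ Fin r → B) (ha : AlgebraicIndependent K (π ∘ a)) :
    ((∀ p, b * p = 0 → p = 0) → Function.Injective π) ∧
    ((∀ z : F, ∃ p q, z = π p / π q) → ∀ z : F, (π : B →+* F).IsIntegralElem z →
      ∃ (k : ℕ) (p : B), z * π b ^ k = π p) := by
  obtain ⟨t, ht⟩ := h
  let L := Localization.Away b
  have hunits : ∀ y : Submonoid.powers b, IsUnit (π y) := by
    rintro ⟨_, k, rfl⟩
    rw [map_pow]
    exact (isUnit_iff_ne_zero.mpr hπb).pow k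
  let φ : L →ₐ[K] F := IsLocalization.liftAlgHom (M := Submonoid.powers b) (f := π) hunits
  have hφ : ∀ p, φ (algebraMap B L p) = π p := fun p => IsLocalization.lift_eq _ p
  let cL : ι → L := fun i => algebraMap B L (c i)
  let v : ι ⊕ Fin r → L := Sum.elim cL t
  have hbL : algebraMap B L b = ∏ i, cL i := (congrArg _ hb).trans (map_prod _ _ _)
  have huu := IsLocalization.Away.mul_invSelf (S := L) b
  have hv : AlgebraicIndependent K (φ ∘ v) := by
    refine algebraicIndependent_of_adjoin_eq_top (algebraMap B L b) cL t ?_ _ huu ht φ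
      (fun i => algebraMap B L (a i)) ?_
    · rw [hbL]
      exact Submonoid.prod_mem _ fun i _ => Submonoid.subset_closure ⟨i, rfl⟩
    · convert ha using 1
      exact funext fun i => hφ (a i)
  have hq : aeval v (∏ i, X (R := K) (Sum.inl i)) = algebraMap B L b := by
    rw [hbL, map_prod]
    exact Finset.prod_congr rfl fun i _ => aeval_X _ _
  have hrange : Set.range v = Set.range cL ∪ Set.range t := Set.Sum.elim_range _ _
  obtain ⟨hφinj, hclosed⟩ := injective_and_isIntegrallyClosed_of_algebraicIndependent
    (∏ i, X (Sum.inl i)) (hq ▸ huu) (by rwa [hrange, ← Set.union_assoc]) φ hv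
  refine ⟨fun hreg => ?_, fun hdiv z hz => ?_⟩
  · rw [injective_iff_map_eq_zero]
    intro p hp
    rw [← hφ, map_eq_zero_iff φ hφinj, IsLocalization.map_eq_zero_iff (Submonoid.powers b)] at hp
    obtain ⟨⟨_, k, rfl⟩, hk⟩ := hp
    induction k with
    | zero => simpa using hk
    | succ k ih =>
      refine ih (hreg _ ?_)
      simpa [pow_succ', mul_assoc] using hk
  · have : IsDomain L := hφinj.isDomain φ.toRingHom
    let := φ.toRingHom.toAlgebra
    have : FaithfulSMul L F := (faithfulSMul_iff_algebraMap_injective L F).mpr hφinj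
    have : IsFractionRing L F := .of_field L F fun z => by
      obtain ⟨p, q, rfl⟩ := hdiv z
      refine ⟨algebraMap B L p, algebraMap B L q, ?_⟩
      rw [← hφ p, ← hφ q]
      rfl
    have hzL : IsIntegral L z := by
      refine RingHom.IsIntegralElem.of_comp (f := algebraMap B L) (g := φ.toRingHom) ?_
      convert hz
      exact RingHom.ext hφ
    obtain ⟨w, rfl⟩ := IsIntegrallyClosed.isIntegral_iff.mp hzL
    obtain ⟨⟨p, ⟨_, k, rfl⟩⟩, hp⟩ := IsLocalization.surj (Submonoid.powers b) w
    refine ⟨k, p, ?_⟩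
    have := congrArg φ hp
    rw [map_mul, hφ, hφ, map_pow] at this
    exact this

end AwayGenerated

/-! ### Presentations and intersections of localizations -/

section CompleteIntersection

open RingTheory.Sequence MvPolynomial

/-- Isomorphisms of rings preserve membership in the ideal generated by a list. -/
lemma Ideal.map_mem_ofList_map_iff {R S : Type*} [CommRing R] [CommRing S] (e : R ≃+* S)
    {rs : List R} {x : R} : e x ∈ Ideal.ofList (rs.map e) ↔ x ∈ Ideal.ofList rs := by
  refine ⟨fun h => ?_, fun h => ?_⟩
  · have h1 := Ideal.mem_map_of_mem (e.symm : S →+* R) h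
    rw [Ideal.map_ofList] at h1
    simpa [Function.comp_def] using h1
  · have h1 := Ideal.mem_map_of_mem (e : R →+* S) h
    rw [Ideal.map_ofList] at h1
    simpa using h1

/-- The variables of the presentation in the definition of a graded complete intersection may be
indexed by any finite type. -/
lemma IsGradedCompleteIntersection.of_presentation {K A σ : Type*} [Field K] [CommRing A]
    [Algebra K A] (𝒜 : ℕ → Submodule K A) [Fintype σ] (w : σ → ℕ) (a : σ → A)
    (rs : List (MvPolynomial σ K)) (ha : ∀ i, 0 < w i ∧ a i ∈ 𝒜 (w i))
    (htop : Algebra.adjoin K (Set.range a) = ⊤)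
    (hhom : ∀ r ∈ rs, ∃ d : ℕ, IsWeightedHomogeneous w r d)
    (hreg : IsRegular (MvPolynomial σ K) rs)
    (hker : RingHom.ker (aeval a : MvPolynomial σ K →ₐ[K] A) = Ideal.ofList rs) :
    IsGradedCompleteIntersection K 𝒜 := by
  let e := Fintype.equivFin σ
  let E := renameEquiv K e
  refine ⟨Fintype.card σ, w ∘ e.symm, a ∘ e.symm, rs.map E, fun i => ha _, ?_, ?_, ?_, ?_⟩
  · rwa [e.symm.surjective.range_comp]
  · intro r hr
    obtain ⟨p, hp, rfl⟩ := List.mem_map.mp hr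
    obtain ⟨d, hd⟩ := hhom p hp
    refine ⟨d, fun c hc => ?_⟩
    obtain ⟨u, rfl, hu⟩ := coeff_rename_ne_zero e p c hc
    rw [← hd hu, Finsupp.weight_apply, Finsupp.weight_apply,
      Finsupp.sum_mapDomain_index (by simp) (by simp [add_mul])]
    simp
  · refine (AddEquiv.isRegular_congr (e := E.toRingEquiv.toAddEquiv) ?_).mp hreg
    rw [List.forall₂_map_right_iff, List.forall₂_same]
    exact fun r _ x => map_mul E r x
  · have hcomp : (aeval (a ∘ e.symm) : MvPolynomial (Fin (Fintype.card σ)) K →ₐ[K] A) =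
        (aeval a).comp E.symm.toAlgHom := by
      ext i
      simp [E]
    ext p
    obtain ⟨q, rfl⟩ := E.surjective p
    rw [hcomp, show Ideal.ofList (rs.map E) = Ideal.ofList (rs.map E.toRingEquiv) from rfl]
    refine Iff.trans ?_ (Ideal.map_mem_ofList_map_iff E.toRingEquiv).symm
    rw [← hker, RingHom.mem_ker, RingHom.mem_ker]
    simp

end CompleteIntersection

section Divisibility

open RingTheory.Sequence

variable {B : Type*} [CommRing B]

/-- If `y` is a nonzerodivisor modulo each of the nonzerodivisors `x ∈ S`, then it is a
nonzerodivisor modulo their products. -/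
lemma dvd_of_dvd_mul_of_mem_closure {S : Set B} {y : B}
    (hS : ∀ x ∈ S, (∀ p, x * p = 0 → p = 0) ∧ ∀ p, x ∣ y * p → x ∣ p) {x : B}
    (hx : x ∈ Submonoid.closure S) : (∀ p, x * p = 0 → p = 0) ∧ ∀ p, x ∣ y * p → x ∣ p := by
  induction hx using Submonoid.closure_induction with
  | mem x hx => exact hS x hx
  | one => exact ⟨fun p hp => by simpa using hp, fun p _ => one_dvd p⟩
  | mul x x' _ _ hx hx' =>
    refine ⟨fun p hp => hx'.1 _ (hx.1 _ (by rwa [← mul_assoc])), fun p hp => ?_⟩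
    obtain ⟨p, rfl⟩ := hx.2 p ((dvd_mul_right x x').trans hp)
    obtain ⟨d, hd⟩ := hp
    refine mul_dvd_mul_left x (hx'.2 p ⟨d, ?_⟩)
    rw [← sub_eq_zero]
    refine hx.1 _ ?_
    linear_combination hd

/-- Products of nonzerodivisors modulo `x` are nonzerodivisors modulo `x`. -/
lemma dvd_of_dvd_mul_of_forall_dvd {S : Set B} {x : B} (hS : ∀ y ∈ S, ∀ p, x ∣ y * p → x ∣ p)
    {y : B} (hy : y ∈ Submonoid.closure S) (p : B) (h : x ∣ y * p) : x ∣ p := by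
  induction hy using Submonoid.closure_induction generalizing p with
  | mem y hy => exact hS y hy p h
  | one => simpa using h
  | mul y y' _ _ hy hy' => exact hy' p (hy _ (by rwa [← mul_assoc]))

/-- An element `z` of an extension domain of `B` that becomes an element of `B` after multiplication
with `x` and after multiplication with `y` lies in `B`, if `y` is a nonzerodivisor modulo `x`. -/
lemma exists_eq_of_mul_eq_of_mul_eq {F : Type*} [CommRing F] [IsDomain F] {π : B →+* F}
    (hπ : Function.Injective π) {x y : B} (hx : π x ≠ 0) (hxy : ∀ p, x ∣ y * p → x ∣ p) {z : F}
    {p q : B} (hp : z * π x = π p) (hq : z * π y = π q) : ∃ r, z = π r := by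
  obtain ⟨r, rfl⟩ := hxy p ⟨q, hπ (by rw [map_mul, map_mul, ← hp, ← hq]; ring)⟩
  exact ⟨r, mul_right_cancel₀ hx (by rw [hp, map_mul, mul_comm])⟩

/-- The entry following an initial segment of a regular sequence is a nonzerodivisor modulo that
segment. -/
lemma RingTheory.Sequence.IsWeaklyRegular.mem_of_mul_mem {rs t : List B} {a : B}
    (h : IsWeaklyRegular B (rs ++ a :: t)) {x : B} (hx : a * x ∈ Ideal.ofList rs) :
    x ∈ Ideal.ofList rs := by
  rw [isWeaklyRegular_self_iff] at h
  have := h rs.length (by simp) x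
  simpa [hx] using this

/-- If a regular sequence starts with `rs, a, b`, then `b` is a nonzerodivisor modulo `a` in the
quotient by the ideal generated by `rs`. -/
lemma RingTheory.Sequence.IsWeaklyRegular.dvd_of_dvd_mul {rs t : List B} {a b : B}
    (h : IsWeaklyRegular B (rs ++ a :: b :: t)) {I : Ideal B} (hI : I = Ideal.ofList rs) (p : B ⧸ I)
    (hp : Ideal.Quotient.mk I a ∣ Ideal.Quotient.mk I b * p) : Ideal.Quotient.mk I a ∣ p := by
  obtain ⟨p, rfl⟩ := Ideal.Quotient.mk_surjective p
  obtain ⟨d, hd⟩ := hp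
  obtain ⟨d, rfl⟩ := Ideal.Quotient.mk_surjective d
  rw [← map_mul, ← map_mul, Ideal.Quotient.mk_eq_mk_iff_sub_mem, hI] at hd
  have h' : IsWeaklyRegular B ((rs ++ [a]) ++ b :: t) := by simpa using h
  have h1 : p ∈ Ideal.ofList (rs ++ [a]) := by
    refine h'.mem_of_mul_mem ?_
    rw [Ideal.ofList_append, Ideal.ofList_singleton]
    have := Ideal.add_mem _ (Ideal.mem_sup_left hd)
      (Ideal.mem_sup_right (S := Ideal.ofList rs) (Ideal.mul_mem_right d _
        (Ideal.mem_span_singleton_self a)))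
    rwa [sub_add_cancel] at this
  rw [Ideal.ofList_append, Ideal.ofList_singleton, ← hI] at h1
  obtain ⟨u, hu, v, hv, rfl⟩ := Submodule.mem_sup.mp h1
  obtain ⟨v, rfl⟩ := Ideal.mem_span_singleton.mp hv
  rw [map_add, Ideal.Quotient.eq_zero_iff_mem.mpr hu, zero_add, map_mul]
  exact dvd_mul_right _ _

end Divisibility

/-! ### The complete intersection -/

section Regularity

open RingTheory.Sequence MvPolynomial

variable {K : Type*} [Field K] {n m l : ℕ}

/-- The relations followed by the variables `X i`, `Y j` in any order form a regular sequence. -/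
lemma isWeaklyRegular_ofFn_append_map {df : Fin n → ℕ} {dg : Fin m → ℕ} {dh : Fin l → ℕ}
    (hw : ∀ i, Sum.elim df (Sum.elim dg dh) i ≠ 0)
    {R : Fin l → MvPolynomial (Fin n ⊕ Fin m ⊕ Fin l) K}
    (hsopP : IsHomogeneousSOP K
      (weightedHomogeneousSubmodule K (Sum.elim df (Sum.elim dg dh)))
      (Sum.elim (fun i : Fin n => X (Sum.inl i))
        (Sum.elim (fun j : Fin m => X (Sum.inr (Sum.inl j))) R)))
    {V : List (Fin n ⊕ Fin m)} (hV : V.Perm Finset.univ.toList) :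
    IsWeaklyRegular (MvPolynomial (Fin n ⊕ Fin m ⊕ Fin l) K)
      (List.ofFn R ++
        V.map (Sum.elim (fun i => X (Sum.inl i)) fun j => X (Sum.inr (Sum.inl j)))) := by
  have hmemV : ∀ v, v ∈ V := fun v => hV.mem_iff.mpr (by simp)
  have hmem : ∀ r, r ∈ List.ofFn R ++ V.map (Sum.elim (fun i => X (Sum.inl i))
      fun j => X (Sum.inr (Sum.inl j))) ↔ r ∈ Set.range (Sum.elim
        (fun i : Fin n => X (R := K) (Sum.inl i))
        (Sum.elim (fun j : Fin m => X (Sum.inr (Sum.inl j))) R)) := by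
    intro r
    simp only [List.mem_append, List.mem_ofFn', List.mem_map, hmemV, true_and, Set.mem_range,
      Sum.exists, Sum.elim_inl, Sum.elim_inr]
    tauto
  have hint := hsopP.integral
  have hset : {r | r ∈ List.ofFn R ++ V.map (Sum.elim (fun i => X (Sum.inl i))
      fun j => X (Sum.inr (Sum.inl j)))} = Set.range (Sum.elim
        (fun i : Fin n => X (R := K) (Sum.inl i))
        (Sum.elim (fun j : Fin m => X (Sum.inr (Sum.inl j))) R)) := Set.ext hmem
  rw [← hset] at hint
  refine isWeaklyRegular_of_isIntegral hw ?_ ?_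
  · intro r hr
    obtain ⟨i, rfl⟩ := (hmem r).mp hr
    exact hsopP.homogeneous i
  · simp only [List.length_append, List.length_ofFn, List.length_map, hV.length_eq,
      Finset.length_toList, Finset.card_univ, Fintype.card_sum, Fintype.card_fin]
    omega

end Regularity

theorem mainTheorem2 {K A : Type*} [Field K] [CommRing A] [IsDomain A] [Algebra K A]
    (𝒜 : ℕ → Submodule K A) [GradedAlgebra 𝒜]
    (n m l : ℕ) (f : Fin n → A) (g : Fin m → A) (h : Fin l → A)
    -- the elements are homogeneous of positive degrees `df`, `dg`, `dh`
    (df : Fin n → ℕ) (dg : Fin m → ℕ) (dh : Fin l → ℕ)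
    (hf : ∀ i, 0 < df i ∧ f i ∈ 𝒜 (df i))
    (hg : ∀ j, 0 < dg j ∧ g j ∈ 𝒜 (dg j))
    (hh : ∀ k, 0 < dh k ∧ h k ∈ 𝒜 (dh k))
    (hsop : IsHomogeneousSOP K 𝒜 (Sum.elim f g))
    (hquot : IntermediateField.adjoin K
      (algebraMap A (FractionRing A) '' (Set.range f ∪ Set.range g ∪ Set.range h)) = ⊤)
    -- homogeneous relations, in the polynomial ring `P` with variables `X i`, `Y j`, `Z k`
    (R : Fin l → MvPolynomial (Fin n ⊕ Fin m ⊕ Fin l) K)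
    (hRhom : ∀ k, ∃ d : ℕ,
      MvPolynomial.IsWeightedHomogeneous (Sum.elim df (Sum.elim dg dh)) (R k) d)
    (hRker : ∀ k, MvPolynomial.aeval (Sum.elim f (Sum.elim g h)) (R k) = 0)
    (hsopP : IsHomogeneousSOP K
      (MvPolynomial.weightedHomogeneousSubmodule K (Sum.elim df (Sum.elim dg dh)))
      (Sum.elim (fun i : Fin n => MvPolynomial.X (Sum.inl i))
        (Sum.elim (fun j : Fin m => MvPolynomial.X (Sum.inr (Sum.inl j))) R)))
    -- generation of `B_x` and `B_y`, where `B = P / (R)`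
    (hBx : AwayGeneratedBy K
      (∏ i : Fin n, Ideal.Quotient.mk (Ideal.span (Set.range R)) (MvPolynomial.X (Sum.inl i)))
      (fun i : Fin n =>
        Ideal.Quotient.mk (Ideal.span (Set.range R)) (MvPolynomial.X (Sum.inl i))) m)
    (hBy : AwayGeneratedBy K
      (∏ j : Fin m,
        Ideal.Quotient.mk (Ideal.span (Set.range R)) (MvPolynomial.X (Sum.inr (Sum.inl j))))
      (fun j : Fin m =>
        Ideal.Quotient.mk (Ideal.span (Set.range R)) (MvPolynomial.X (Sum.inr (Sum.inl j)))) n) :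
    Algebra.adjoin K (Set.range f ∪ Set.range g ∪ Set.range h) = ⊤ ∧
      IsGradedCompleteIntersection K 𝒜 ∧
      RingHom.ker (MvPolynomial.aeval (Sum.elim f (Sum.elim g h)) :
        MvPolynomial (Fin n ⊕ Fin m ⊕ Fin l) K →ₐ[K] A) = Ideal.span (Set.range R) := by
  have hweight : ∀ i, 0 < Sum.elim df (Sum.elim dg dh) i ∧
      Sum.elim f (Sum.elim g h) i ∈ 𝒜 (Sum.elim df (Sum.elim dg dh) i) := by
    rintro (i | j | k)
    exacts [hf i, hg j, hh k]
  have hreg := fun {V} => isWeaklyRegular_ofFn_append_map (V := V)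
    (fun i => (hweight i).1.ne') hsopP
  have hI : Ideal.span (Set.range R) = Ideal.ofList (List.ofFn R) := by
    rw [Ideal.ofList]
    congr 1
    ext r
    simp [List.mem_ofFn']
  set φ : MvPolynomial (Fin n ⊕ Fin m ⊕ Fin l) K →ₐ[K] A :=
    MvPolynomial.aeval (Sum.elim f (Sum.elim g h)) with hφ
  set I := Ideal.span (Set.range R)
  set Xb : Fin n → MvPolynomial (Fin n ⊕ Fin m ⊕ Fin l) K ⧸ I :=
    fun i => Ideal.Quotient.mk I (MvPolynomial.X (Sum.inl i)) with hXb
  set Yb : Fin m → MvPolynomial (Fin n ⊕ Fin m ⊕ Fin l) K ⧸ I :=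
    fun j => Ideal.Quotient.mk I (MvPolynomial.X (Sum.inr (Sum.inl j))) with hYb
  have hIφ : I ≤ RingHom.ker φ := by
    rw [Ideal.span_le]
    rintro _ ⟨k, rfl⟩
    exact hRker k
  have hperm : ∀ (V : List (Fin n ⊕ Fin m)) (v), v ∈ V → ∃ t, (v :: t).Perm V := by
    intro V v hv
    obtain ⟨s, t, rfl⟩ := List.append_of_mem hv
    exact ⟨s ++ t, List.perm_middle.symm⟩
  -- each `X i` is a nonzerodivisor on `B`, and each `Y j` is one modulo each `X i`
  have hXreg : ∀ i p, Xb i * p = 0 → p = 0 := by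
    intro i p hp
    obtain ⟨p, rfl⟩ := Ideal.Quotient.mk_surjective p
    rw [hXb, ← map_mul, Ideal.Quotient.eq_zero_iff_mem, hI] at hp
    rw [Ideal.Quotient.eq_zero_iff_mem, hI]
    obtain ⟨t, ht⟩ := hperm _ (Sum.inl i) (Finset.mem_toList.mpr (Finset.mem_univ _))
    exact (hreg ht).mem_of_mul_mem hp
  have hXYreg : ∀ i j p, Xb i ∣ Yb j * p → Xb i ∣ p := by
    intro i j p hp
    obtain ⟨t, ht⟩ := hperm _ (Sum.inl i) (Finset.mem_toList.mpr (Finset.mem_univ _))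
    obtain ⟨t', ht'⟩ := hperm t (Sum.inr j) (by
      have := ht.mem_iff.mpr (Finset.mem_toList.mpr (Finset.mem_univ (Sum.inr j)))
      simpa using this)
    exact (hreg ((ht'.cons _).trans ht)).dvd_of_dvd_mul hI p hp
  set π : (MvPolynomial (Fin n ⊕ Fin m ⊕ Fin l) K ⧸ I) →ₐ[K] FractionRing A :=
    (IsScalarTower.toAlgHom K A (FractionRing A)).comp (Ideal.Quotient.liftₐ I φ hIφ) with hπ
  have hπmk : ∀ p, π (Ideal.Quotient.mk I p) = algebraMap A (FractionRing A) (φ p) := fun p => rfl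
  have hinjF : Function.Injective (algebraMap A (FractionRing A)) := IsFractionRing.injective A _
  have hπX : ∀ i, π (Xb i) = algebraMap A (FractionRing A) (f i) := fun i => by
    rw [hXb, hπmk, hφ, MvPolynomial.aeval_X, Sum.elim_inl]
  have hπY : ∀ j, π (Yb j) = algebraMap A (FractionRing A) (g j) := fun j => by
    rw [hYb, hπmk, hφ, MvPolynomial.aeval_X, Sum.elim_inr, Sum.elim_inl]
  have halg : AlgebraicIndependent K (π ∘ Sum.elim Xb Yb) := by
    have h1 := hsop.algebraicIndependent.map' (f := IsScalarTower.toAlgHom K A (FractionRing A))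
      hinjF
    convert h1 using 1
    funext i
    rcases i with i | j
    exacts [hπX i, hπY j]
  have halg' : AlgebraicIndependent K (π ∘ Sum.elim Yb Xb) := by
    have h1 := halg.comp Sum.swap Sum.swap_leftInverse.injective
    convert h1 using 1
    funext i
    rcases i with i | j <;> rfl
  have hπx : π (∏ i, Xb i) ≠ 0 := by
    rw [map_prod]
    exact Finset.prod_ne_zero_iff.mpr fun i _ => halg.ne_zero (Sum.inl i)
  have hπy : π (∏ j, Yb j) ≠ 0 := by
    rw [map_prod]
    exact Finset.prod_ne_zero_iff.mpr fun j _ => halg.ne_zero (Sum.inr j)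
  obtain ⟨hinj, hx⟩ := hBx.injective_and_exists_mul_pow_eq rfl π hπx _ halg
  obtain ⟨-, hy⟩ := hBy.injective_and_exists_mul_pow_eq rfl π hπy _ halg'
  have hXclosure : ∏ i, Xb i ∈ Submonoid.closure (Set.range Xb) :=
    Submonoid.prod_mem _ fun i _ => Submonoid.subset_closure ⟨i, rfl⟩
  have hYclosure : ∏ j, Yb j ∈ Submonoid.closure (Set.range Yb) :=
    Submonoid.prod_mem _ fun j _ => Submonoid.subset_closure ⟨j, rfl⟩
  -- `x` is a nonzerodivisor on `B`, and powers of `y` are nonzerodivisors modulo powers of `x`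
  have hclosure : ∀ y ∈ Submonoid.closure (Set.range Yb),
      ∀ x ∈ Submonoid.closure (Set.range Xb),
        (∀ p, x * p = 0 → p = 0) ∧ ∀ p, x ∣ y * p → x ∣ p := by
    intro y hy x hx
    refine dvd_of_dvd_mul_of_mem_closure ?_ hx
    rintro _ ⟨i, rfl⟩
    refine ⟨hXreg i, fun p => dvd_of_dvd_mul_of_forall_dvd ?_ hy p⟩
    rintro _ ⟨j, rfl⟩
    exact hXYreg i j
  have hπinj : Function.Injective π := hinj (hclosure _ hYclosure _ hXclosure).1
  have hker : RingHom.ker φ = I := by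
    refine le_antisymm (fun p hp => ?_) hIφ
    rw [← Ideal.Quotient.eq_zero_iff_mem]
    exact hπinj (by rw [hπmk, RingHom.mem_ker.mp hp, map_zero, map_zero])
  have hrangeφ : Algebra.adjoin K (Set.range f ∪ Set.range g ∪ Set.range h) = φ.range := by
    rw [hφ, ← Algebra.adjoin_range_eq_range_aeval, Set.Sum.elim_range, Set.Sum.elim_range,
      Set.union_assoc]
  have hdiv : ∀ z : FractionRing A, ∃ p q, z = π p / π q := by
    intro z
    have hz : z ∈ IntermediateField.adjoin K
        (algebraMap A (FractionRing A) '' (Set.range f ∪ Set.range g ∪ Set.range h)) :=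
      hquot ▸ IntermediateField.mem_top
    obtain ⟨r, hr, s, hs, rfl⟩ := IntermediateField.mem_adjoin_iff_div.mp hz
    have hle : Algebra.adjoin K
        (algebraMap A (FractionRing A) '' (Set.range f ∪ Set.range g ∪ Set.range h)) ≤ π.range := by
      rw [Algebra.adjoin_le_iff]
      rintro _ ⟨a, ha, rfl⟩
      obtain ⟨p, rfl⟩ : a ∈ φ.range := hrangeφ ▸ Algebra.subset_adjoin ha
      exact ⟨Ideal.Quotient.mk I p, rfl⟩
    obtain ⟨p, rfl⟩ := hle hr
    obtain ⟨q, rfl⟩ := hle hs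
    exact ⟨p, q, rfl⟩
  -- `A` is integral over `K[f, g]`, and the inclusion of `K[f, g]` into `F` factors through `B`
  have hintegral : ∀ a : A,
      (π : MvPolynomial (Fin n ⊕ Fin m ⊕ Fin l) K ⧸ I →+* FractionRing A).IsIntegralElem
        (algebraMap A (FractionRing A) a) := by
    intro a
    have := hsop.integral
    have h1 : IsIntegral (Algebra.adjoin K (Set.range (Sum.elim f g)))
      (algebraMap A (FractionRing A) a) := (this.isIntegral a).algebraMap
    let ψ : MvPolynomial (Fin n ⊕ Fin m) K →ₐ[K] MvPolynomial (Fin n ⊕ Fin m ⊕ Fin l) K ⧸ I :=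
      MvPolynomial.aeval (Sum.elim Xb Yb)
    let e := hsop.algebraicIndependent.aevalEquiv
    refine RingHom.IsIntegralElem.of_comp (f := (ψ.comp e.symm.toAlgHom).toRingHom) ?_
    have h2 : ∀ q, π (ψ q) =
        algebraMap A (FractionRing A) (MvPolynomial.aeval (Sum.elim f g) q) := fun q => by
      rw [MvPolynomial.comp_aeval_apply, ← MvPolynomial.aeval_algebraMap_apply]
      congr 2
      funext i
      rcases i with i | j
      exacts [hπX i, hπY j]
    have h3 : (π : MvPolynomial (Fin n ⊕ Fin m ⊕ Fin l) K ⧸ I →+* FractionRing A).comp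
        (ψ.comp e.symm.toAlgHom).toRingHom =
        algebraMap (Algebra.adjoin K (Set.range (Sum.elim f g))) (FractionRing A) := by
      ext s
      obtain ⟨q, rfl⟩ := e.surjective s
      refine (congrArg (fun t => π (ψ t)) (e.symm_apply_apply q)).trans ((h2 q).trans ?_)
      rw [IsScalarTower.algebraMap_apply (Algebra.adjoin K (Set.range (Sum.elim f g))) A]
      exact congrArg _ (hsop.algebraicIndependent.algebraMap_aevalEquiv q).symm
    rw [h3]
    exact h1
  -- an element of `A` lies in the image of `B_x` and of `B_y`, hence in that of `B`
  have hsurj : φ.range = ⊤ := by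
    rw [eq_top_iff]
    rintro a -
    obtain ⟨k, p, hp⟩ := hx hdiv _ (hintegral a)
    obtain ⟨j, q, hq⟩ := hy hdiv _ (hintegral a)
    rw [← map_pow] at hp hq
    obtain ⟨r, hr⟩ := exists_eq_of_mul_eq_of_mul_eq
      (π := (π : MvPolynomial (Fin n ⊕ Fin m ⊕ Fin l) K ⧸ I →+* FractionRing A)) hπinj
      (by rw [RingHom.coe_coe, map_pow]; exact pow_ne_zero k hπx)
      (hclosure _ (Submonoid.pow_mem _ hYclosure j) _ (Submonoid.pow_mem _ hXclosure k)).2 hp hq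
    obtain ⟨r, rfl⟩ := Ideal.Quotient.mk_surjective r
    exact ⟨r, (hinjF hr).symm⟩
  refine ⟨hrangeφ.trans hsurj, ?_, hker⟩
  refine .of_presentation 𝒜 (Sum.elim df (Sum.elim dg dh)) (Sum.elim f (Sum.elim g h))
    (List.ofFn R) hweight ?_ ?_ ⟨?_, ?_⟩ (hker.trans hI)
  · rw [Algebra.adjoin_range_eq_range_aeval]
    exact hsurj
  · intro r hr
    obtain ⟨k, rfl⟩ : r ∈ Set.range R := by simpa [List.mem_ofFn'] using hr
    exact hRhom k
  · exact ((RingTheory.Sequence.isWeaklyRegular_append_iff _ _ _).mp (hreg (List.Perm.refl _))).1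
  · rw [smul_eq_mul, Ideal.mul_top, ← hI, ← hker]
    exact (RingHom.ker_ne_top _).symm
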